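/- All graphs are finite and simple. For a vertex $x$ of a graph $G=(V,E)$, let $N(x)$ be its set of neighbours and $N[x]=N(x)\cup\{x\}$, and for $S\subseteq V$ let $G\setminus S$ be the graph obtained by deleting the vertices of $S$ and all incident edges ($G\setminus x=G\setminus\{x\}$). A graph is *well-covered* if all its maximal (by inclusion) independent sets have the same cardinality. A graph $G$ is *very well-covered* if it is well-covered, has no isolated vertices, and every maximal independent set has cardinality $|V|/2$. A graph $G$ is *vertex decomposable* if it is well-covered and either it has no edges (possibly no vertices), or there is a vertex $x$ such that $G\setminus x$ and $G\setminus N[x]$ are both vertex decomposable. Put $$\mathrm{Shed}(G)=\{x\in V \mid G\setminus x \text{ and } G\setminus N[x] \text{ are vertex decomposable}\}.$$ A set $D\subseteq V$ is a *dominating set* if every vertex of $V\setminus D$ is adjacent to a vertex of $D$. A *leaf* is a vertex with exactly one neighbour. **Theorem.** Let $G$ be a very well-covered graph. If $G$ is vertex decomposable, then $\mathrm{Shed}(G)$ is a dominating set of $G$. Moreover, the set of all neighbours of leaves of $G$ is contained in $\mathrm{Shed}(G)$ and is already a dominating set of $G$. -/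

import Mathlib

universe u

namespace SimpleGraph

variable {V : Type u} (G : SimpleGraph V)

/-- All maximal independent sets have the same cardinality (used for finite graphs only). -/
def IsWellCovered : Prop :=
  ∀ s t : Set V, Maximal G.IsIndepSet s → Maximal G.IsIndepSet t → s.ncard = t.ncard

/-- Well-covered, and every maximal independent set contains exactly half of the vertices. -/
def IsVeryWellCovered : Prop :=
  G.IsWellCovered ∧ ∀ s : Set V, Maximal G.IsIndepSet s → 2 * s.ncard = Nat.card V

/-- `G \ x`: the vertex `x` and its incident edges are removed. -/
abbrev removeVertex (x : V) : SimpleGraph ({x}ᶜ : Set V) :=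
  G.induce ({x}ᶜ : Set V)

/-- `G \ N[x]`: the closed neighbourhood of `x` and all incident edges are removed. -/
abbrev removeClosedNbhd (x : V) : SimpleGraph ((insert x (G.neighborSet x))ᶜ : Set V) :=
  G.induce ((insert x (G.neighborSet x))ᶜ : Set V)

/-- Vertex decomposability (in the pure sense) of a finite graph. The first constructor includes
the graph without vertices. -/
inductive IsVertexDecomposable : {V : Type u} → SimpleGraph V → Prop
  | edgeless {V : Type u} (G : SimpleGraph V) (hwc : G.IsWellCovered)
      (h : ∀ v w : V, ¬ G.Adj v w) : IsVertexDecomposable G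
  | shedding {V : Type u} (G : SimpleGraph V) (hwc : G.IsWellCovered) (x : V)
      (hdel : IsVertexDecomposable (G.removeVertex x))
      (hlink : IsVertexDecomposable (G.removeClosedNbhd x)) : IsVertexDecomposable G

/-- The set of shedding vertices of `G`. -/
def shed : Set V :=
  {x | (G.removeVertex x).IsVertexDecomposable ∧ (G.removeClosedNbhd x).IsVertexDecomposable}

/-- Every vertex outside `D` is adjacent to a vertex of `D`. -/
def IsDominatingSet (D : Set V) : Prop :=
  ∀ v : V, v ∉ D → ∃ d ∈ D, G.Adj v d

/-- The set of all neighbours of leaves, a leaf being a vertex with exactly one neighbour. -/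
def leafNeighbors : Set V :=
  {v | ∃ z : V, (G.neighborSet z).ncard = 1 ∧ G.Adj z v}

end SimpleGraph

/-!
By Berge's inequality (`ncard_le_ncard_neighbors`) and Hall's theorem, a very well-covered graph
without isolated vertices has a perfect matching, encoded as an involution `σ` with `v ~ σ v`. Every
maximal independent set meets each matching edge exactly once, and this forces Favaron's exchange
property: `a ~ σ v` and `v ~ c` imply `a ~ c` (`exists_isPairing`).

Read `a ~ σ b` as `a ≤ b`. The exchange property says that this relation is transitive, so it is a
preorder, which `σ` reverses. Its antisymmetry (`IsRigid`) is equivalent to vertex decomposability: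

* if `G \ x` is well-covered, then the exchange property makes `σ x` a leaf, hence two distinct
  equivalent vertices `a`, `b`, whose square `a, σ a, b, σ b` has no leaf, survive in `G \ x`; by
  induction a vertex decomposable graph is rigid (`IsVertexDecomposable.isRigid`);
* rigidity is inherited by the graphs obtained by deleting a minimal vertex or its closed
  neighbourhood, and graphs with a pairing are well-covered, so a rigid graph is vertex decomposable
  (`IsPairing.isVertexDecomposable`).

The neighbours of leaves are exactly the minimal vertices, so they are shedding. A vertex `v` is
adjacent to every minimal vertex below `σ v`, and such a vertex exists by finiteness, so they
dominate.

Deleting vertices can create isolated vertices. The notion of a pairing therefore allows them and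
imposes no condition on them beyond `σ` being an involution.
-/

namespace SimpleGraph

/-! ### Independent sets -/

section IndepSet

variable {V : Type u} {G : SimpleGraph V} {s t : Set V}

lemma IsIndepSet.not_adj (hs : G.IsIndepSet s) {a b : V} (ha : a ∈ s) (hb : b ∈ s) :
    ¬ G.Adj a b := fun h => hs ha hb h.ne h

lemma isIndepSet_of_not_adj (hs : ∀ a ∈ s, ∀ b ∈ s, ¬ G.Adj a b) : G.IsIndepSet s :=
  fun a ha b hb _ => hs a ha b hb

lemma IsIndepSet.subset (ht : G.IsIndepSet t) (h : s ⊆ t) : G.IsIndepSet s :=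
  Set.Pairwise.mono h ht

lemma isIndepSet_insert (hs : G.IsIndepSet s) {x : V} (hx : ∀ a ∈ s, ¬ G.Adj a x) :
    G.IsIndepSet (insert x s) := by
  refine isIndepSet_of_not_adj ?_
  rintro a (rfl | ha) b (rfl | hb)
  · exact G.irrefl
  · exact fun h => hx b hb h.symm
  · exact hx a ha
  · exact hs.not_adj ha hb

lemma isIndepSet_pair {a b : V} (h : ¬ G.Adj a b) : G.IsIndepSet {a, b} :=
  isIndepSet_insert (Set.pairwise_singleton _ _) (by rintro c rfl; exact fun hc => h hc.symm)

lemma IsIndepSet.exists_maximal [Finite V] (hs : G.IsIndepSet s) :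
    ∃ t, s ⊆ t ∧ Maximal G.IsIndepSet t :=
  Finite.exists_le_maximal hs

lemma exists_adj_of_maximal (hs : Maximal G.IsIndepSet s) {v : V} (hv : v ∉ s) :
    ∃ a ∈ s, G.Adj a v := by
  by_contra! h
  exact hv (hs.2 (isIndepSet_insert hs.1 h) (Set.subset_insert v s) (Set.mem_insert v s))

lemma IsWellCovered.ncard_le [Finite V] (hG : G.IsWellCovered) (hs : G.IsIndepSet s)
    (ht : Maximal G.IsIndepSet t) : s.ncard ≤ t.ncard := by
  obtain ⟨m, hsm, hm⟩ := hs.exists_maximal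
  exact (Set.ncard_le_ncard hsm).trans_eq (hG m t hm ht)

lemma isIndepSet_image_val {W : Set V} {t : Set W} (ht : (G.induce W).IsIndepSet t) :
    G.IsIndepSet (Subtype.val '' t) := by
  refine isIndepSet_of_not_adj ?_
  rintro _ ⟨a, ha, rfl⟩ _ ⟨b, hb, rfl⟩
  exact ht.not_adj ha hb

lemma maximal_preimage_val {W : Set V} (hs : Maximal G.IsIndepSet s) (hsW : s ⊆ W) :
    Maximal (G.induce W).IsIndepSet (Subtype.val ⁻¹' s) := by
  refine ⟨isIndepSet_of_not_adj fun a ha b hb => hs.1.not_adj ha hb, fun t ht hst a ha => ?_⟩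
  refine hs.2 (isIndepSet_image_val ht) (fun b hb => ?_) (Set.mem_image_of_mem _ ha)
  exact ⟨⟨b, hsW hb⟩, hst hb, rfl⟩

end IndepSet

/-! ### Berge's inequality and perfect matchings -/

section Matching

variable {V : Type u} [Finite V] {G : SimpleGraph V}

/-- **Berge's inequality**: in a well-covered graph without isolated vertices, an independent set
has at least as many neighbours as elements. -/
lemma ncard_le_ncard_neighbors (hG : G.IsWellCovered) (hiso : ∀ v, ∃ w, G.Adj v w)
    (A : Set V) (hA : G.IsIndepSet A) : A.ncard ≤ {w | ∃ a ∈ A, G.Adj a w}.ncard := by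
  induction hn : A.ncard using Nat.strong_induction_on generalizing A with
  | _ n ih =>
  subst hn
  rcases A.eq_empty_or_nonempty with rfl | ⟨a, ha⟩
  · simp
  obtain ⟨v, hav⟩ := hiso a
  obtain ⟨M, hvM, hM⟩ := IsIndepSet.exists_maximal (G := G) (s := {v}) (Set.pairwise_singleton _ _)
  have haM : a ∉ M := fun h => hM.1.not_adj h (hvM rfl) hav
  set N : Set V := {w | ∃ a ∈ A, G.Adj a w} with hN
  -- Exchanging `M ∩ N` for `A \ M` in `M` keeps independence, which bounds `|A \ M|`.
  have hdiff : (A \ M).ncard ≤ (M ∩ N).ncard := by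
    have hind : G.IsIndepSet ((M \ N) ∪ (A \ M)) := by
      refine isIndepSet_of_not_adj ?_
      rintro b (hb | hb) c (hc | hc) hbc
      · exact hM.1.not_adj hb.1 hc.1 hbc
      · exact hb.2 ⟨c, hc.1, hbc.symm⟩
      · exact hc.2 ⟨b, hb.1, hbc⟩
      · exact hA.not_adj hb.1 hc.1 hbc
    have h1 := hG.ncard_le hind hM
    rw [Set.ncard_union_eq (Set.disjoint_left.2 fun b hb hb' => hb'.2 hb.1)] at h1
    have h2 := Set.ncard_inter_add_ncard_sdiff_eq_ncard M N
    omega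
  have hsub : (A ∩ M).ncard < A.ncard :=
    Set.ncard_lt_ncard ⟨Set.inter_subset_left, fun h => haM (h ha).2⟩
  have hih := ih _ hsub (A ∩ M) (hA.subset Set.inter_subset_left) rfl
  have hdisj : Disjoint {w | ∃ a ∈ A ∩ M, G.Adj a w} (M ∩ N) := by
    refine Set.disjoint_left.2 ?_
    rintro w ⟨b, hb, hbw⟩ hw
    exact hM.1.not_adj hb.2 hw.1 hbw
  have hunion : {w | ∃ a ∈ A ∩ M, G.Adj a w} ∪ (M ∩ N) ⊆ N := by
    rintro w (⟨b, hb, hbw⟩ | hw)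
    · exact ⟨b, hb.1, hbw⟩
    · exact hw.2
  have h3 := Set.ncard_le_ncard hunion
  rw [Set.ncard_union_eq hdisj] at h3
  have h4 := Set.ncard_inter_add_ncard_sdiff_eq_ncard A M
  omega

/-- A very well-covered graph without isolated vertices has a perfect matching. -/
lemma exists_perfect_matching (hG : G.IsVeryWellCovered) (hiso : ∀ v, ∃ w, G.Adj v w) :
    ∃ σ : V → V, Function.Involutive σ ∧ ∀ v, G.Adj v (σ v) := by
  classical
  have := Fintype.ofFinite V
  obtain ⟨S, -, hS⟩ := IsIndepSet.exists_maximal (G := G) (s := ∅) (Set.pairwise_empty _)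
  obtain ⟨f, hf, hadj⟩ := (Fintype.all_card_le_filter_rel_iff_exists_injective
      fun (a : S) (b : V) => G.Adj a b).1 fun A => by
    have h := ncard_le_ncard_neighbors hG.1 hiso (Subtype.val '' (A : Set S))
      (hS.1.subset (by rintro _ ⟨a, -, rfl⟩; exact a.2))
    rw [Set.ncard_image_of_injective _ Subtype.val_injective, Set.ncard_coe_finset] at h
    refine h.trans_eq ?_
    rw [← Set.ncard_coe_finset]
    congr 1
    ext w
    simp
  have hfS : ∀ a, f a ∈ Sᶜ := fun a h => hS.1.not_adj a.2 h (hadj a)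
  have hcard : Nat.card S = Nat.card (Sᶜ : Set V) := by
    have h1 := hG.2 S hS
    have h2 := Set.ncard_add_ncard_compl S
    rw [Nat.card_coe_set_eq, Nat.card_coe_set_eq]
    omega
  have hbij : Function.Bijective fun a : S => (⟨f a, hfS a⟩ : (Sᶜ : Set V)) :=
    (Nat.bijective_iff_injective_and_card _).2
      ⟨fun a b h => hf (congrArg Subtype.val h), hcard⟩
  let e := Equiv.ofBijective _ hbij
  have he : ∀ a : S, G.Adj a (e a) := hadj
  refine ⟨fun v => if h : v ∈ S then e ⟨v, h⟩ else e.symm ⟨v, h⟩, fun v => ?_, fun v => ?_⟩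
  · by_cases h : v ∈ S
    · have h' : (e ⟨v, h⟩ : V) ∉ S := (e ⟨v, h⟩).2
      simp [h, h']
    · simp [h]
  · by_cases h : v ∈ S
    · simpa [h] using he ⟨v, h⟩
    · simpa [h] using (he (e.symm ⟨v, h⟩)).symm

end Matching

/-! ### Pairings -/

section Pairing

variable {V : Type u}

/-- `σ` matches the non-isolated vertices of `G` perfectly and has Favaron's exchange property.
Isolated vertices are only required to be permuted by the involution `σ`. -/
structure IsPairing (G : SimpleGraph V) (σ : V → V) : Prop where
  involutive : Function.Involutive σ
  adj_self : ∀ {v w : V}, G.Adj v w → G.Adj v (σ v)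
  adj_trans : ∀ {a v c : V}, G.Adj a (σ v) → G.Adj v c → G.Adj a c

/-- The preorder `a ~ σ b` of a pairing is antisymmetric. Equivalently, no two matching edges
`{a, σ a}` and `{b, σ b}` are joined by a further pair of edges into an alternating square. -/
def IsRigid (G : SimpleGraph V) (σ : V → V) : Prop :=
  ∀ a b : V, G.Adj a (σ b) → G.Adj b (σ a) → a = b

theorem exists_isPairing [Finite V] {G : SimpleGraph V} (hG : G.IsVeryWellCovered)
    (hiso : ∀ v, ∃ w, G.Adj v w) : ∃ σ, G.IsPairing σ := by
  obtain ⟨σ, hσ, hadj⟩ := exists_perfect_matching hG hiso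
  refine ⟨σ, hσ, fun {v _} _ => hadj v, fun {a v c} hav hvc => ?_⟩
  by_contra hac
  -- Otherwise `{a, c}` lies in a maximal independent set missing the matching edge `{v, σ v}`.
  obtain ⟨M, hsub, hM⟩ := (isIndepSet_pair hac).exists_maximal
  have hv : v ∉ M := fun h => hM.1.not_adj h (hsub (Or.inr rfl)) hvc
  have hσv : σ v ∉ M := fun h => hM.1.not_adj (hsub (Or.inl rfl)) h hav
  have hdisj : Disjoint M (σ '' M) := by
    refine Set.disjoint_left.2 ?_
    rintro _ hb ⟨b, hb', rfl⟩
    exact hM.1.not_adj hb' hb (hadj b)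
  have hcard : (M ∪ σ '' M).ncard = Nat.card V := by
    rw [Set.ncard_union_eq hdisj, Set.ncard_image_of_injective _ hσ.injective, ← hG.2 M hM, two_mul]
  have huniv : M ∪ σ '' M = Set.univ :=
    Set.eq_of_subset_of_ncard_le (Set.subset_univ _) (by rw [Set.ncard_univ, hcard])
  rcases huniv.ge (Set.mem_univ v) with h | ⟨b, hb, rfl⟩
  · exact hv h
  · exact hσv (by rwa [hσ b])

namespace IsPairing

variable {G : SimpleGraph V} {σ : V → V}

lemma mem_or_mem (h : G.IsPairing σ) {t : Set V} (ht : Maximal G.IsIndepSet t) (v : V) :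
    v ∈ t ∨ σ v ∈ t := by
  by_contra! hv
  obtain ⟨c, hc, hcv⟩ := exists_adj_of_maximal ht hv.1
  obtain ⟨a, ha, hav⟩ := exists_adj_of_maximal ht hv.2
  exact ht.1.not_adj ha hc (h.adj_trans hav hcv.symm)

lemma isWellCovered [Finite V] (h : G.IsPairing σ) : G.IsWellCovered := by
  classical
  suffices key : ∀ s t : Set V, Maximal G.IsIndepSet s → Maximal G.IsIndepSet t →
      s.ncard ≤ t.ncard from fun s t hs ht => (key s t hs ht).antisymm (key t s ht hs)
  intro s t hs ht
  have hadj : ∀ v ∉ t, G.Adj v (σ v) := fun v hv =>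
    let ⟨_, _, ha⟩ := exists_adj_of_maximal ht hv
    h.adj_self ha.symm
  refine Set.ncard_le_ncard_of_injOn (fun v => if v ∈ t then v else σ v) (fun v _ => ?_) ?_
  · by_cases hv : v ∈ t
    · simp [hv]
    · simpa [hv] using (h.mem_or_mem ht v).resolve_left hv
  · intro a ha b hb hab
    by_cases hat : a ∈ t <;> by_cases hbt : b ∈ t <;> simp only [hat, hbt, if_true, if_false] at hab
    · exact hab
    · exact (hs.1.not_adj hb ha (hab ▸ hadj b hbt)).elim
    · exact (hs.1.not_adj ha hb (hab ▸ hadj a hat)).elim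
    · exact h.involutive.injective hab

/-- If deleting `x` leaves a well-covered graph, then the partner of `x` is a leaf. -/
lemma eq_of_adj_partner [Finite V] (h : G.IsPairing σ) {x c : V}
    (hx : (G.removeVertex x).IsWellCovered) (hxx : G.Adj x (σ x)) (hc : G.Adj (σ x) c) :
    c = x := by
  by_contra hcx
  obtain ⟨T, hcT, hT⟩ := IsIndepSet.exists_maximal (G := G.removeVertex x)
    (s := {(⟨c, hcx⟩ : ({x}ᶜ : Set V))}) (Set.pairwise_singleton _ _)
  obtain ⟨S, hxS, hS⟩ := IsIndepSet.exists_maximal (G := G) (s := {σ x})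
    (Set.pairwise_singleton _ _)
  have hSx : S ⊆ ({x}ᶜ : Set V) := by
    rintro _ ha rfl
    exact hS.1.not_adj ha (hxS rfl) hxx
  have hST : S.ncard = T.ncard := by
    rw [← hx _ _ (maximal_preimage_val hS hSx) hT]
    exact (Set.ncard_preimage_of_injective_subset_range Subtype.val_injective
      (by rwa [Subtype.range_val])).symm
  -- `T ∪ {x}` is independent: a neighbour of `x` in `T` would be adjacent to `c ∈ T`.
  have hind : G.IsIndepSet (insert x (Subtype.val '' T)) := by
    refine isIndepSet_insert (isIndepSet_image_val hT.1) ?_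
    rintro _ ⟨a, ha, rfl⟩ hax
    exact hT.1.not_adj ha (hcT rfl) (h.adj_trans (by rwa [h.involutive x]) hc)
  have hle := h.isWellCovered.ncard_le hind hS
  rw [Set.ncard_insert_of_notMem (by rintro ⟨a, -, ha⟩; exact a.2 ha),
    Set.ncard_image_of_injective _ Subtype.val_injective] at hle
  omega

end IsPairing

/-! ### Restriction to induced subgraphs -/

open Classical in
/-- The restriction of `σ` to `W`, fixing the elements of `W` that `σ` sends outside `W`. -/
noncomputable def restrictMap (σ : V → V) (W : Set V) (v : W) : W :=
  if h : σ v ∈ W then ⟨σ v, h⟩ else v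

lemma restrictMap_of_mem {σ : V → V} {W : Set V} {v : W} (h : σ v ∈ W) :
    restrictMap σ W v = ⟨σ v, h⟩ := dif_pos h

lemma restrictMap_of_notMem {σ : V → V} {W : Set V} {v : W} (h : σ v ∉ W) :
    restrictMap σ W v = v := dif_neg h

/-- Every vertex of `W` that is not isolated in the induced subgraph on `W` has its partner
in `W`. -/
def IsPairingClosed (G : SimpleGraph V) (σ : V → V) (W : Set V) : Prop :=
  ∀ v ∈ W, ∀ w ∈ W, G.Adj v w → σ v ∈ W

lemma IsRigid.restrict {G : SimpleGraph V} {σ : V → V} {W : Set V} (hr : G.IsRigid σ)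
    (hW : G.IsPairingClosed σ W) :
    (G.induce W).IsRigid (restrictMap σ W) := by
  have key : ∀ a b : W, (G.induce W).Adj a (restrictMap σ W b) → G.Adj a (σ b) := by
    intro a b hab
    by_cases hb : σ b ∈ W
    · rw [restrictMap_of_mem hb] at hab
      exact hab
    · rw [restrictMap_of_notMem hb] at hab
      exact (hb (hW b b.2 a a.2 hab.symm)).elim
  exact fun a b hab hba => Subtype.ext (hr a b (key a b hab) (key b a hba))

namespace IsPairing

variable {G : SimpleGraph V} {σ : V → V} {W : Set V}

lemma restrict (h : G.IsPairing σ) (hW : G.IsPairingClosed σ W) :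
    (G.induce W).IsPairing (restrictMap σ W) where
  involutive v := by
    by_cases hv : σ v ∈ W
    · have hv' : σ (σ v) ∈ W := by rw [h.involutive]; exact v.2
      rw [restrictMap_of_mem hv, restrictMap_of_mem hv']
      exact Subtype.ext (h.involutive v)
    · rw [restrictMap_of_notMem hv, restrictMap_of_notMem hv]
  adj_self {v w} hvw := by
    rw [restrictMap_of_mem (hW v v.2 w w.2 hvw)]
    exact h.adj_self hvw
  adj_trans {a v c} hav hvc := by
    rw [restrictMap_of_mem (hW v v.2 c c.2 hvc)] at hav
    exact h.adj_trans (a := a.1) (v := v.1) (c := c.1) hav hvc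

lemma isPairingClosed_compl_singleton (h : G.IsPairing σ) {x : V}
    (hx : ∀ c, G.Adj (σ x) c → c = x) : G.IsPairingClosed σ ({x}ᶜ : Set V) := by
  rintro v - w hw hvw rfl
  exact hw (hx w (by rwa [h.involutive v]))

lemma isPairingClosed_compl_closedNbhd (h : G.IsPairing σ) (x : V) :
    G.IsPairingClosed σ ((insert x (G.neighborSet x))ᶜ : Set V) := by
  rintro v hv w hw hvw (hx | hx)
  · subst hx
    exact hv (Or.inr (h.adj_self hvw).symm)
  · exact hw (Or.inr (h.adj_trans hx hvw))

end IsPairing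

end Pairing

/-! ### Vertex decomposability is rigidity -/

section VertexDecomposable

variable {V : Type u} {G : SimpleGraph V}

lemma IsVertexDecomposable.isWellCovered (h : G.IsVertexDecomposable) : G.IsWellCovered := by
  cases h <;> assumption

theorem IsVertexDecomposable.isRigid (hG : G.IsVertexDecomposable) :
    ∀ [Finite V] {σ : V → V}, G.IsPairing σ → G.IsRigid σ := by
  induction hG with
  | edgeless G _ h => exact fun _ a b hab _ => (h _ _ hab).elim
  | shedding G _ x hdel _ ih _ =>
    intro _ σ h
    have hleaf : ∀ c, G.Adj (σ x) c → c = x := fun c hc =>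
      h.eq_of_adj_partner hdel.isWellCovered
        (by simpa [h.involutive x] using (h.adj_self hc).symm) hc
    have hW := h.isPairingClosed_compl_singleton hleaf
    have hr := ih (h.restrict hW)
    intro a b hab hba
    by_contra hne
    have haa := h.adj_self hab
    have hbb := h.adj_self hba
    -- No vertex of the square `a, σ a, b, σ b` is `x`, since otherwise its partner would be the
    -- leaf `σ x` and have two neighbours.
    have hax : a ≠ x := by
      rintro rfl
      exact hne (hleaf b hba.symm).symm
    have hbx : b ≠ x := by
      rintro rfl
      exact hne (hleaf a hab.symm)
    have hσa : σ a ≠ x := by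
      rintro rfl
      rw [h.involutive] at hleaf
      exact hne (h.involutive.injective (hleaf _ hab)).symm
    have hσb : σ b ≠ x := by
      rintro rfl
      rw [h.involutive] at hleaf
      exact hne (h.involutive.injective (hleaf _ hba))
    have := hr ⟨a, hax⟩ ⟨b, hbx⟩ (by rw [restrictMap_of_mem hσb]; exact hab)
      (by rw [restrictMap_of_mem hσa]; exact hba)
    exact hne (congrArg Subtype.val this)

/-- If `σ v` is not isolated, there is a minimal vertex `d` for the partial order `a ~ σ b` below
`σ v`, so that `v ~ d` and `d` is the only neighbour of its partner. -/
lemma IsPairing.exists_adj_minimal [Finite V] {σ : V → V} (h : G.IsPairing σ)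
    (hr : G.IsRigid σ) {v w : V} (hv : G.Adj v w) :
    ∃ d, G.Adj v d ∧ ∀ c, G.Adj (σ d) c → c = d := by
  -- Reflexivity is added by hand, as `a ~ σ a` fails for isolated `a`.
  let _ : PartialOrder V :=
    { le := fun a b => a = b ∨ G.Adj a (σ b)
      le_refl := fun a => Or.inl rfl
      le_trans := by
        rintro a b c (rfl | hab) (rfl | hbc)
        · exact Or.inl rfl
        · exact Or.inr hbc
        · exact Or.inr hab
        · exact Or.inr (h.adj_trans hab hbc)
      le_antisymm := by
        rintro a b (rfl | hab) (hba | hba)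
        · rfl
        · rfl
        · exact hba.symm
        · exact hr a b hab hba }
  obtain ⟨d, hd, hmin⟩ := Finite.exists_le_minimal (p := fun _ : V => True) (a := σ v) trivial
  refine ⟨d, ?_, fun c hc => ?_⟩
  · rcases hd with rfl | hd
    · exact h.adj_self hv
    · rw [h.involutive v] at hd
      exact hd.symm
  · have hcd : c ≤ d := Or.inr hc.symm
    exact le_antisymm hcd (hmin.2 trivial hcd)

theorem IsPairing.isVertexDecomposable {V : Type u} [Finite V] {G : SimpleGraph V} {σ : V → V}
    (h : G.IsPairing σ) (hr : G.IsRigid σ) : G.IsVertexDecomposable := by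
  induction hn : Nat.card V using Nat.strong_induction_on generalizing V with
  | _ n ih =>
  subst hn
  by_cases hE : ∀ v w, ¬ G.Adj v w
  · exact .edgeless G h.isWellCovered hE
  push Not at hE
  obtain ⟨v, w, hvw⟩ := hE
  obtain ⟨d, -, hd⟩ := h.exists_adj_minimal hr hvw
  have hcard : ∀ W : Set V, d ∉ W → Nat.card W < Nat.card V := fun W hdW => by
    rw [Nat.card_coe_set_eq, ← Set.ncard_univ]
    exact Set.ncard_lt_ncard (Set.ssubset_univ_iff.2 fun hW => hdW (hW ▸ Set.mem_univ d))
  have hdel := h.isPairingClosed_compl_singleton hd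
  have hlink := h.isPairingClosed_compl_closedNbhd d
  exact .shedding G h.isWellCovered d
    (ih _ (hcard _ (by simp)) (h.restrict hdel) (hr.restrict hdel) rfl)
    (ih _ (hcard _ (by simp)) (h.restrict hlink) (hr.restrict hlink) rfl)

/-- A vertex whose partner has no other neighbour is shedding. -/
lemma IsPairing.mem_shed [Finite V] {σ : V → V} (h : G.IsPairing σ) (hr : G.IsRigid σ) {x : V}
    (hx : ∀ c, G.Adj (σ x) c → c = x) : x ∈ G.shed :=
  have hdel := h.isPairingClosed_compl_singleton hx
  have hlink := h.isPairingClosed_compl_closedNbhd x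
  ⟨(h.restrict hdel).isVertexDecomposable (hr.restrict hdel),
    (h.restrict hlink).isVertexDecomposable (hr.restrict hlink)⟩

end VertexDecomposable

end SimpleGraph

theorem theorem4p2 {V : Type*} [Finite V] (G : SimpleGraph V)
    (hiso : ∀ v : V, ∃ w : V, G.Adj v w)
    (hvwc : G.IsVeryWellCovered) (hvd : G.IsVertexDecomposable) :
    G.IsDominatingSet G.shed ∧
      G.leafNeighbors ⊆ G.shed ∧ G.IsDominatingSet G.leafNeighbors := by
  obtain ⟨σ, h⟩ := SimpleGraph.exists_isPairing hvwc hiso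
  have hr := hvd.isRigid h
  have hadj : ∀ v, G.Adj v (σ v) := fun v => h.adj_self (hiso v).choose_spec
  have hsub : G.leafNeighbors ⊆ G.shed := by
    rintro x ⟨z, hz, hzx⟩
    obtain ⟨y, hy⟩ := Set.ncard_eq_one.1 hz
    have hleaf : ∀ c, G.Adj z c → c = y := fun c hc => hy.le hc
    obtain rfl : x = σ z := (hleaf x hzx).trans (hleaf _ (hadj z)).symm
    refine h.mem_shed hr fun c hc => ?_
    rw [h.involutive z] at hc
    exact (hleaf c hc).trans (hleaf _ hzx).symm
  have hdom : ∀ v, ∃ d ∈ G.leafNeighbors, G.Adj v d := by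
    intro v
    obtain ⟨d, hvd, hd⟩ := h.exists_adj_minimal hr (hadj v)
    refine ⟨d, ⟨σ d, Set.ncard_eq_one.2 ⟨d, ?_⟩, (hadj d).symm⟩, hvd⟩
    exact Set.eq_singleton_iff_unique_mem.2 ⟨(hadj d).symm, hd⟩
  exact ⟨fun v _ => let ⟨d, hd, hvd⟩ := hdom v; ⟨d, hsub hd, hvd⟩, hsub, fun v _ => hdom v⟩
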